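/- Define the Rudin–Shapiro polynomials by $P_0(z)=Q_0(z)=1$ and, for $t\ge 0$, $P_{t+1}(z)=P_t(z)+z^{2^t}Q_t(z)$ and $Q_{t+1}(z)=P_t(z)-z^{2^t}Q_t(z)$. Let $a_n$ be the common coefficient of $z^n$ in all $P_t$ with $2^t>n$, and for $n\ge 0$ let $P_{<n}(z)=\sum_{i=0}^{n-1}a_iz^i$. Then for every integer $n\ge1$ and every complex $z$ with $|z|=1$, $$|P_{<n}(z)|\le\sqrt{6n-2}-1.$$ In particular $|P_{<n}(z)|\le\sqrt6\,\sqrt n$ for all $n\ge 0$ and $|z|=1$. The first bound is sharp at $z=1$ for infinitely many $n$: for every integer $k\ge 0$, the number $n=(2\cdot4^k+1)/3$ is a positive integer and $|P_{<n}(1)|=2^{k+1}-1=\sqrt{6n-2}-1$. -/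

import Mathlib

namespace RudinShapiro

open Polynomial

/-- The pair `(P_t, Q_t)` of Rudin–Shapiro polynomials: `P_0 = Q_0 = 1`,
`P_{t+1} = P_t + X^(2^t) Q_t` and `Q_{t+1} = P_t - X^(2^t) Q_t`. -/
noncomputable def pair : ℕ → ℤ[X] × ℤ[X]
  | 0 => (1, 1)
  | t + 1 =>
    ((pair t).1 + X ^ (2 ^ t) * (pair t).2, (pair t).1 - X ^ (2 ^ t) * (pair t).2)

/-- The Rudin–Shapiro polynomial `P_t`. -/
noncomputable def P (t : ℕ) : ℤ[X] := (pair t).1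

/-- The companion Rudin–Shapiro polynomial `Q_t`. -/
noncomputable def Q (t : ℕ) : ℤ[X] := (pair t).2

/-- The Rudin–Shapiro coefficient `a_n`: the common coefficient of `X^n` in all `P_t` with
`n < 2^t` (see `coeff_P_eq_a`), read off at `t = n`. -/
noncomputable def a (n : ℕ) : ℤ := (P n).coeff n

/-- The partial sum `P_{<n}(z) = ∑_{i < n} a_i z^i` of the power series `∑ a_i z^i`. -/
noncomputable def partialSum (n : ℕ) (z : ℂ) : ℂ := ∑ i ∈ Finset.range n, (a i : ℂ) * z ^ i

/-- The first `2^t` coefficients of `P_{t+k}` are those of `P_t`. -/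
theorem coeff_P_add {n t : ℕ} (h : n < 2 ^ t) (k : ℕ) :
    (P (t + k)).coeff n = (P t).coeff n := by
  induction k with
  | zero => rfl
  | succ k ih =>
    have h2 : ¬ 2 ^ (t + k) ≤ n := by
      have := Nat.pow_le_pow_right (n := 2) (by norm_num) (Nat.le_add_right t k)
      omega
    have e : P (t + (k + 1)) = P (t + k) + X ^ (2 ^ (t + k)) * Q (t + k) := rfl
    rw [e, coeff_add, coeff_X_pow_mul', if_neg h2, add_zero, ih]

/-- The coefficient `a_n` is well defined: it is the coefficient of `X^n` in every `P_t`
with `n < 2^t`. -/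
theorem coeff_P_eq_a {n t : ℕ} (h : n < 2 ^ t) : (P t).coeff n = a n := by
  unfold a
  rcases le_total t n with htn | hnt
  · obtain ⟨k, rfl⟩ := Nat.exists_eq_add_of_le htn
    exact (coeff_P_add h k).symm
  · obtain ⟨k, rfl⟩ := Nat.exists_eq_add_of_le hnt
    exact coeff_P_add Nat.lt_two_pow_self k

end RudinShapiro

namespace RudinShapiro

open Polynomial

/-! Each block of length 2^j of the sequence is, up to sign, the coefficient list of P_j or Q_j
(`a_block`), and |P_j|² + |Q_j|² = 2^(j+1) on the unit circle.

Let n = N + m with N a power of 2 and m ≤ N/2. Then |P_{<n}| ≤ √(2N) + |P_{<m}|, and √(2N) + √(6m-2)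
≤ √(6n-2) as long as 6m-2 ≤ 2N (`sqrt_add_sqrt_le`). This is the inductive step for n up to about
2/3 of the next power of 2; its equality case 6m-2 = 2N, iterated, gives the sharp lengths.

Just above 2/3 the induction carries a second bound, 2√(2^t) - 1 for n < (23/32)2^t. Removing the
leading 2^(t-1) terms sends n/2^t = 1/2 + x/4 to x = m/2^(t-2), and 1/2 + (23/32)/4 = 87/128. So
only n/2^t in [87/128, 23/32], and [23/32, 1) for the first bound, need a direct argument.

There P_{<n} is compared with the midpoint of the sums at the two ends of a block containing n
(`norm_partialSum_block_add_le`). By Cauchy–Schwarz the midpoint is controlled by a bound |E|² +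
|O|² ≤ K for explicit polynomials, certified in integer arithmetic (`norm_sq_evens_add_le`). -/

/-! ### Block structure of the coefficients -/

theorem P_zero : P 0 = 1 := rfl

theorem Q_zero : Q 0 = 1 := rfl

theorem P_succ (t : ℕ) : P (t + 1) = P t + X ^ (2 ^ t) * Q t := rfl

theorem Q_succ (t : ℕ) : Q (t + 1) = P t - X ^ (2 ^ t) * Q t := rfl

/-- The polynomial which, up to sign, gives the `k`-th block of length `2 ^ j` of the
Rudin–Shapiro coefficients. -/
noncomputable def block (j k : ℕ) : ℤ[X] := if Even k then P j else Q j

theorem block_even {j k : ℕ} (h : Even k) : block j k = P j := if_pos h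

theorem block_odd {j k : ℕ} (h : ¬ Even k) : block j k = Q j := if_neg h

theorem coeff_P_succ_of_lt {t n : ℕ} (h : n < 2 ^ t) : (P (t + 1)).coeff n = (P t).coeff n :=
  coeff_P_add h 1

theorem coeff_Q_succ_of_lt {t n : ℕ} (h : n < 2 ^ t) : (Q (t + 1)).coeff n = (P t).coeff n := by
  rw [Q_succ, coeff_sub, coeff_X_pow_mul', if_neg (by omega), sub_zero]

theorem coeff_PQ_eq_zero {t n : ℕ} (h : 2 ^ t ≤ n) : (P t).coeff n = 0 ∧ (Q t).coeff n = 0 := by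
  induction t generalizing n with
  | zero =>
    rw [P_zero, Q_zero, coeff_one, if_neg (by simp at h; omega)]
    exact ⟨rfl, rfl⟩
  | succ t ih =>
    have h1 : 2 ^ t ≤ n := by rw [pow_succ] at h; omega
    have h2 : 2 ^ t ≤ n - 2 ^ t := by rw [pow_succ] at h; omega
    simp [P_succ, Q_succ, coeff_X_pow_mul', ih h1, ih h2]

theorem coeff_P_succ_add (t r : ℕ) :
    (P (t + 1)).coeff (2 ^ t + r) = (Q t).coeff r := by
  simp [P_succ, coeff_X_pow_mul', (coeff_PQ_eq_zero (Nat.le_add_right (2 ^ t) r)).1]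

theorem coeff_Q_succ_add (t r : ℕ) :
    (Q (t + 1)).coeff (2 ^ t + r) = -(Q t).coeff r := by
  simp [Q_succ, coeff_X_pow_mul', (coeff_PQ_eq_zero (Nat.le_add_right (2 ^ t) r)).1]

/-- The upper half of P_(t+1) is Q_t, so P and Q must be treated together. The level is s + 1
because at level 0 the Q-half would claim that Q_j and P_j agree. -/
theorem coeff_block (j s : ℕ) {k r : ℕ} (hk : k < 2 ^ (s + 1)) (hr : r < 2 ^ j) :
    (P (j + (s + 1))).coeff (k * 2 ^ j + r) = (P (s + 1)).coeff k * (block j k).coeff r ∧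
    (Q (j + (s + 1))).coeff (k * 2 ^ j + r) = (Q (s + 1)).coeff k * (block j k).coeff r := by
  induction s generalizing k with
  | zero =>
    have hk' : k = 0 ∨ k = 1 := by simp at hk; omega
    rcases hk' with rfl | rfl
    · have h1 : (P (0 + 1)).coeff 0 = 1 ∧ (Q (0 + 1)).coeff 0 = 1 := by
        simp [P_succ, Q_succ, P_zero, Q_zero]
      rw [h1.1, h1.2, zero_mul, zero_add, zero_add, coeff_P_succ_of_lt hr, coeff_Q_succ_of_lt hr,
        block_even Even.zero, one_mul]
      exact ⟨rfl, rfl⟩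
    · have h1 : (P (0 + 1)).coeff 1 = 1 ∧ (Q (0 + 1)).coeff 1 = -1 := by
        simp [P_succ, Q_succ, P_zero, Q_zero, coeff_one]
      rw [h1.1, h1.2, one_mul, zero_add, coeff_P_succ_add, coeff_Q_succ_add,
        block_odd Nat.not_even_one, one_mul, neg_one_mul]
      exact ⟨rfl, rfl⟩
  | succ s ih =>
    rw [← Nat.add_assoc j (s + 1) 1]
    rcases lt_or_ge k (2 ^ (s + 1)) with h | h
    · have hlt : k * 2 ^ j + r < 2 ^ (j + (s + 1)) := by
        rw [Nat.pow_add 2 j]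
        nlinarith
      rw [coeff_P_succ_of_lt hlt, coeff_Q_succ_of_lt hlt, coeff_P_succ_of_lt h,
        coeff_Q_succ_of_lt h]
      exact ⟨(ih h).1, (ih h).1⟩
    · obtain ⟨k, rfl⟩ := Nat.exists_eq_add_of_le h
      have hk' : k < 2 ^ (s + 1) := by rw [pow_succ 2 (s + 1)] at hk; omega
      have e : (2 ^ (s + 1) + k) * 2 ^ j + r = 2 ^ (j + (s + 1)) + (k * 2 ^ j + r) := by ring
      have hb : block j (2 ^ (s + 1) + k) = block j k := by
        have : Even (2 ^ (s + 1) + k) ↔ Even k := by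
          rw [Nat.even_add]
          simp [Nat.even_pow]
        simp only [block, this]
      rw [e, coeff_P_succ_add, coeff_Q_succ_add, coeff_P_succ_add, coeff_Q_succ_add, hb,
        (ih hk').2]
      exact ⟨rfl, by ring⟩

/-- The `k`-th block of length `2 ^ j` of the Rudin–Shapiro sequence. -/
theorem a_block (j : ℕ) {k r : ℕ} (hr : r < 2 ^ j) :
    a (k * 2 ^ j + r) = a k * (block j k).coeff r := by
  have hk : k < 2 ^ (k + 1) := lt_trans k.lt_succ_self Nat.lt_two_pow_self
  have hn : k * 2 ^ j + r < 2 ^ (j + (k + 1)) := by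
    rw [Nat.pow_add 2 j]
    nlinarith
  rw [← coeff_P_eq_a hn, ← coeff_P_eq_a hk]
  exact (coeff_block j k hk hr).1

/-! ### Truncations and values on the unit circle -/

/-- `T(z) = ∑_{i < m} c_i z^i` for an integer polynomial `T = ∑ c_i X^i`. -/
noncomputable def trunc (T : ℤ[X]) (m : ℕ) (z : ℂ) : ℂ :=
  ∑ i ∈ Finset.range m, (T.coeff i : ℂ) * z ^ i

theorem trunc_P_eq_partialSum {t m : ℕ} (h : m ≤ 2 ^ t) (z : ℂ) :
    trunc (P t) m z = partialSum m z := by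
  refine Finset.sum_congr rfl fun i hi => ?_
  rw [coeff_P_eq_a ((Finset.mem_range.1 hi).trans_le h)]

theorem partialSum_block_add (j k : ℕ) {m : ℕ} (hm : m ≤ 2 ^ j) (z : ℂ) :
    partialSum (k * 2 ^ j + m) z =
      partialSum (k * 2 ^ j) z + a k * (z ^ 2 ^ j) ^ k * trunc (block j k) m z := by
  unfold partialSum trunc
  rw [Finset.sum_range_add, Finset.mul_sum]
  congr 1
  refine Finset.sum_congr rfl fun i hi => ?_
  rw [a_block j ((Finset.mem_range.1 hi).trans_le hm), pow_add, mul_comm k, pow_mul]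
  push_cast
  ring

theorem trunc_succ_of_le {t m : ℕ} (h : m ≤ 2 ^ t) (z : ℂ) :
    trunc (P (t + 1)) m z = trunc (P t) m z ∧ trunc (Q (t + 1)) m z = trunc (P t) m z := by
  constructor <;> refine Finset.sum_congr rfl fun i hi => ?_
  · rw [coeff_P_succ_of_lt ((Finset.mem_range.1 hi).trans_le h)]
  · rw [coeff_Q_succ_of_lt ((Finset.mem_range.1 hi).trans_le h)]

/-- Evaluation of an integer polynomial at a complex number. -/
noncomputable def val (T : ℤ[X]) (z : ℂ) : ℂ := T.eval₂ (Int.castRingHom ℂ) z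

theorem val_PQ_succ (t : ℕ) (z : ℂ) :
    val (P (t + 1)) z = val (P t) z + z ^ 2 ^ t * val (Q t) z ∧
    val (Q (t + 1)) z = val (P t) z - z ^ 2 ^ t * val (Q t) z := by
  simp [val, P_succ, Q_succ, eval₂_add, eval₂_sub, eval₂_mul, eval₂_pow]

theorem val_zero (z : ℂ) : val (P 0) z = 1 ∧ val (Q 0) z = 1 := by
  simp [val, P_zero, Q_zero]

theorem trunc_succ_add (t m : ℕ) (z : ℂ) :
    trunc (P (t + 1)) (2 ^ t + m) z =
      trunc (P t) (2 ^ t) z + z ^ 2 ^ t * trunc (Q t) m z ∧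
    trunc (Q (t + 1)) (2 ^ t + m) z =
      trunc (P t) (2 ^ t) z - z ^ 2 ^ t * trunc (Q t) m z := by
  have h := trunc_succ_of_le (le_refl (2 ^ t)) z
  unfold trunc at h ⊢
  constructor
  · rw [Finset.sum_range_add, h.1, Finset.mul_sum]
    congr 1
    refine Finset.sum_congr rfl fun i _ => ?_
    rw [coeff_P_succ_add]
    ring
  · rw [Finset.sum_range_add, h.2, Finset.mul_sum, sub_eq_add_neg, ← Finset.sum_neg_distrib]
    congr 1
    refine Finset.sum_congr rfl fun i _ => ?_
    rw [coeff_Q_succ_add]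
    push_cast
    ring

theorem trunc_full (t : ℕ) (z : ℂ) :
    trunc (P t) (2 ^ t) z = val (P t) z ∧ trunc (Q t) (2 ^ t) z = val (Q t) z := by
  induction t with
  | zero => simp [trunc, val, P_zero, Q_zero]
  | succ t ih =>
    have h := trunc_succ_add t (2 ^ t) z
    rw [← two_mul, ← pow_succ'] at h
    rw [h.1, h.2, (val_PQ_succ t z).1, (val_PQ_succ t z).2, ih.1, ih.2]
    exact ⟨rfl, rfl⟩

theorem partialSum_two_pow (t : ℕ) (z : ℂ) : partialSum (2 ^ t) z = val (P t) z := by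
  rw [← trunc_P_eq_partialSum le_rfl, (trunc_full t z).1]

theorem a_zero : a 0 = 1 := by simp [a, P_zero]

theorem a_two : a 2 = 1 := by
  have h := a_block 1 (k := 1) (r := 0) (by norm_num)
  have h1 := a_block 1 (k := 0) (r := 1) (by norm_num)
  norm_num [block, P_succ, Q_succ, P_zero, Q_zero, a_zero, coeff_one, coeff_X] at h h1
  rw [h, h1]

/-- The two halves of a partial sum whose length lies in the lower half of a dyadic interval. -/
theorem partialSum_two_pow_succ_add (t : ℕ) {m : ℕ} (hm : m ≤ 2 ^ t) (z : ℂ) :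
    partialSum (2 ^ (t + 1) + m) z =
      val (P (t + 1)) z + z ^ 2 ^ (t + 1) * partialSum m z := by
  have h := partialSum_block_add t 2 hm z
  rw [← pow_succ', partialSum_two_pow, a_two, block_even even_two, trunc_P_eq_partialSum hm,
    ← pow_mul, ← pow_succ] at h
  simpa using h

theorem norm_sq_val_PQ (t : ℕ) {z : ℂ} (hz : ‖z‖ = 1) :
    ‖val (P t) z‖ ^ 2 + ‖val (Q t) z‖ ^ 2 = 2 * 2 ^ t := by
  induction t with
  | zero => rw [(val_zero z).1, (val_zero z).2]; norm_num
  | succ t ih =>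
    have h := parallelogram_law_with_norm ℝ (val (P t) z) (z ^ 2 ^ t * val (Q t) z)
    rw [norm_mul, norm_pow, hz, one_pow, one_mul] at h
    rw [(val_PQ_succ t z).1, (val_PQ_succ t z).2, pow_succ (2 : ℝ)]
    linarith

theorem norm_val_PQ_le (t : ℕ) {z : ℂ} (hz : ‖z‖ = 1) :
    ‖val (P t) z‖ ≤ √2 * √(2 ^ t) ∧ ‖val (Q t) z‖ ≤ √2 * √(2 ^ t) := by
  have h := norm_sq_val_PQ t hz
  rw [← Real.sqrt_mul (by norm_num)]
  constructor <;> apply Real.le_sqrt_of_sq_le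
  · nlinarith [sq_nonneg ‖val (Q t) z‖]
  · nlinarith [sq_nonneg ‖val (P t) z‖]

/-- Passing from t to t + 1 adds half of a full P_t or Q_t, of norm at most (√2/2)√(2^t). The
constant c = 1 + √2/2 solves c + √2/2 = √2 c, and the term -1 survives because it is not scaled. -/
theorem norm_trunc_sub_half_le (t : ℕ) {m : ℕ} (hm : m ≤ 2 ^ t) {z : ℂ} (hz : ‖z‖ = 1) :
    ‖trunc (P t) m z - val (P t) z / 2‖ ≤ (1 + √2 / 2) * √(2 ^ t) - 1 ∧
    ‖trunc (Q t) m z - val (Q t) z / 2‖ ≤ (1 + √2 / 2) * √(2 ^ t) - 1 := by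
  have h2 : √2 * √2 = (2 : ℝ) := Real.mul_self_sqrt (by norm_num)
  induction t generalizing m with
  | zero =>
    have h3 : 1 ≤ √(2 : ℝ) := Real.one_le_sqrt.2 (by norm_num)
    have hm' : m = 0 ∨ m = 1 := by simp at hm; omega
    have e : ‖(1 : ℂ) - 1 / 2‖ = 1 / 2 := by norm_num
    rcases hm' with rfl | rfl <;> simp [trunc, val, P_zero, Q_zero] <;> norm_num at e ⊢ <;>
      linarith
  | succ t ih =>
    have hs : √((2 : ℝ) ^ (t + 1)) = √2 * √(2 ^ t) := by
      rw [pow_succ', Real.sqrt_mul (by norm_num)]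
    have hn := norm_val_PQ_le t hz
    have hz' : ‖z ^ 2 ^ t‖ = 1 := by rw [norm_pow, hz, one_pow]
    have key : ∀ x y : ℂ, ‖x‖ ≤ (1 + √2 / 2) * √(2 ^ t) - 1 → ‖y‖ ≤ √2 * √(2 ^ t) →
        ‖x + y / 2‖ ≤ (1 + √2 / 2) * √(2 ^ (t + 1)) - 1 := by
      intro x y hx hy
      have : ‖y / 2‖ = ‖y‖ / 2 := by simp
      have := norm_add_le x (y / 2)
      rw [hs]
      nlinarith [Real.sqrt_nonneg ((2 : ℝ) ^ t)]
    rw [(val_PQ_succ t z).1, (val_PQ_succ t z).2]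
    rcases le_total m (2 ^ t) with h | h
    · rw [(trunc_succ_of_le h z).1, (trunc_succ_of_le h z).2]
      constructor
      · convert key _ (-(z ^ 2 ^ t * val (Q t) z)) (ih h).1 ?_ using 2
        · ring
        · rw [norm_neg, norm_mul, hz', one_mul]; exact hn.2
      · convert key _ (z ^ 2 ^ t * val (Q t) z) (ih h).1 ?_ using 2
        · ring
        · rw [norm_mul, hz', one_mul]; exact hn.2
    · obtain ⟨m, rfl⟩ := Nat.exists_eq_add_of_le h
      have hm' : m ≤ 2 ^ t := by rw [pow_succ] at hm; omega
      rw [(trunc_succ_add t m z).1, (trunc_succ_add t m z).2, (trunc_full t z).1]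
      have hq := (ih hm').2
      constructor
      · convert key (z ^ 2 ^ t * (trunc (Q t) m z - val (Q t) z / 2)) (val (P t) z) ?_ hn.1 using 2
        · ring
        · rwa [norm_mul, hz', one_mul]
      · convert key (-(z ^ 2 ^ t * (trunc (Q t) m z - val (Q t) z / 2))) (val (P t) z) ?_ hn.1
          using 2
        · ring
        · rwa [norm_neg, norm_mul, hz', one_mul]

theorem norm_trunc_block_sub_half_le (t k : ℕ) {m : ℕ} (hm : m ≤ 2 ^ t) {z : ℂ} (hz : ‖z‖ = 1) :
    ‖trunc (block t k) m z - val (block t k) z / 2‖ ≤ (1 + √2 / 2) * √(2 ^ t) - 1 := by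
  unfold block
  split_ifs
  exacts [(norm_trunc_sub_half_le t hm hz).1, (norm_trunc_sub_half_le t hm hz).2]

/-! ### Certified bounds for cosine polynomials -/

/-- `∑ l_k v^k` for a list `l` of integer coefficients. -/
noncomputable def listVal : List ℤ → ℂ → ℂ
  | [], _ => 0
  | c :: l, v => c + v * listVal l v

/-- `∑ l_k Re (v^k)` for a list `l` of integer coefficients. -/
noncomputable def cosVal (l : List ℤ) (v : ℂ) : ℝ := (listVal l v).re

/-- Termwise sum of coefficient lists. -/
def listAdd : List ℤ → List ℤ → List ℤ
  | [], l => l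
  | c :: l, [] => c :: l
  | c :: l, d :: m => (c + d) :: listAdd l m

/-- The coefficients of `|listVal l v|^2` as a cosine polynomial, for `|v| = 1`. -/
def autocorr : List ℤ → List ℤ
  | [] => []
  | c :: l => listAdd (c * c :: l.map (2 * c * ·)) (autocorr l)

/-- An upper bound for a cosine polynomial. -/
def cosBound : List ℤ → ℤ
  | [] => 0
  | c :: l => c + (l.map abs).sum

/-- Every other entry of a list, beginning with the first. -/
def evens : List ℤ → List ℤ
  | [] => []
  | [c] => [c]
  | c :: _ :: l => c :: evens l

theorem listVal_add (l m : List ℤ) (v : ℂ) :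
    listVal (listAdd l m) v = listVal l v + listVal m v := by
  induction l generalizing m with
  | nil => simp [listAdd, listVal]
  | cons c l ih =>
    cases m with
    | nil => simp [listAdd, listVal]
    | cons d m =>
      simp only [listAdd, listVal, ih]
      push_cast
      ring

theorem listVal_map_mul (c : ℤ) (l : List ℤ) (v : ℂ) :
    listVal (l.map (c * ·)) v = c * listVal l v := by
  induction l with
  | nil => simp [listVal]
  | cons d l ih =>
    simp only [List.map_cons, listVal, ih]
    push_cast
    ring

/-- For |v| = 1, |c + vL|² = c² + 2c Re(vL) + |L|², which is the recursion of `autocorr`. -/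
theorem norm_sq_listVal (l : List ℤ) {v : ℂ} (hv : ‖v‖ = 1) :
    ‖listVal l v‖ ^ 2 = cosVal (autocorr l) v := by
  induction l with
  | nil => simp [listVal, cosVal, autocorr]
  | cons c l ih =>
    have hv' : v.re * v.re + v.im * v.im = 1 := by
      rw [← Complex.normSq_apply, Complex.normSq_eq_norm_sq, hv, one_pow]
    rw [cosVal, autocorr, listVal_add, Complex.add_re]
    change _ = _ + cosVal (autocorr l) v
    rw [← ih]
    simp only [listVal, listVal_map_mul, ← Complex.normSq_eq_norm_sq, Complex.normSq_apply,
      Complex.add_re, Complex.add_im, Complex.mul_re, Complex.mul_im, Complex.intCast_re,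
      Complex.intCast_im, Int.cast_mul, Int.cast_ofNat, Complex.re_ofNat, Complex.im_ofNat]
    linear_combination ((listVal l v).re ^ 2 + (listVal l v).im ^ 2) * hv'

theorem norm_listVal_le (l : List ℤ) {v : ℂ} (hv : ‖v‖ = 1) :
    ‖listVal l v‖ ≤ ((l.map abs).sum : ℤ) := by
  induction l with
  | nil => simp [listVal]
  | cons c l ih =>
    simp only [listVal, List.map_cons, List.sum_cons]
    refine (norm_add_le _ _).trans ?_
    rw [norm_mul, hv, one_mul, Complex.norm_intCast]
    push_cast at ih ⊢
    linarith

theorem cosVal_le (l : List ℤ) {v : ℂ} (hv : ‖v‖ = 1) : cosVal l v ≤ cosBound l := by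
  cases l with
  | nil => simp [cosVal, cosBound, listVal]
  | cons c l =>
    have h1 := norm_listVal_le l hv
    have h2 := Complex.re_le_norm (v * listVal l v)
    rw [norm_mul, hv, one_mul] at h2
    simp only [cosVal, cosBound, listVal, Complex.add_re, Complex.intCast_re]
    push_cast at h1 ⊢
    linarith

/-- If `M^2 (K - |E|^2 - |O|^2) - |G|^2` has a nonnegative lower bound read off from its
coefficients, where `E` and `O` are the even and odd parts of `l`, then `|E|^2 + |O|^2 ≤ K` on the
unit circle. -/
theorem norm_sq_evens_add_le {l g : List ℤ} {M K : ℤ} (hM : 0 < M)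
    (h : cosBound (listAdd ((listAdd (autocorr (evens l)) (autocorr (evens l.tail))).map
      (M * M * ·)) (autocorr g)) ≤ M * M * K) {v : ℂ} (hv : ‖v‖ = 1) :
    ‖listVal (evens l) v‖ ^ 2 + ‖listVal (evens l.tail) v‖ ^ 2 ≤ K := by
  have h1 := cosVal_le (listAdd ((listAdd (autocorr (evens l)) (autocorr (evens l.tail))).map
      (M * M * ·)) (autocorr g)) hv
  have h2 : (cosBound (listAdd ((listAdd (autocorr (evens l)) (autocorr (evens l.tail))).map
      (M * M * ·)) (autocorr g)) : ℝ) ≤ ((M * M * K : ℤ) : ℝ) := by exact_mod_cast h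
  have hM' : (0 : ℝ) < (M : ℝ) * M := by
    have : (0 : ℝ) < M := by exact_mod_cast hM
    positivity
  have hg := norm_sq_listVal g hv
  have h3 : cosVal (listAdd ((listAdd (autocorr (evens l)) (autocorr (evens l.tail))).map
      (M * M * ·)) (autocorr g)) v =
      M * M * (‖listVal (evens l) v‖ ^ 2 + ‖listVal (evens l.tail) v‖ ^ 2) +
        ‖listVal g v‖ ^ 2 := by
    rw [norm_sq_listVal _ hv, norm_sq_listVal _ hv, norm_sq_listVal _ hv]
    simp only [cosVal, listVal_add, listVal_map_mul]
    simp
  push_cast at h2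
  have := sq_nonneg ‖listVal g v‖
  exact le_of_mul_le_mul_left (by linarith) hM'

/-! ### Sums of blocks via Cauchy–Schwarz -/

/-- `∑ l_k z^k T_k` where `T_k` is `p` for even `k` and `q` for odd `k`. -/
noncomputable def alternating : List ℤ → ℂ → ℂ → ℂ → ℂ
  | [], _, _, _ => 0
  | c :: l, z, p, q => c * p + z * alternating l z q p

theorem alternating_append_singleton (l : List ℤ) (c : ℤ) (z p q : ℂ) :
    alternating (l ++ [c]) z p q =
      alternating l z p q + c * z ^ l.length * if Even l.length then p else q := by
  induction l generalizing p q with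
  | nil => simp [alternating]
  | cons d l ih =>
    simp only [List.cons_append, alternating, ih, List.length_cons, Nat.even_add_one, ite_not]
    split_ifs <;> ring

theorem alternating_map_mul (c : ℤ) (l : List ℤ) (z p q : ℂ) :
    alternating (l.map (c * ·)) z p q = c * alternating l z p q := by
  induction l generalizing p q with
  | nil => simp [alternating]
  | cons d l ih =>
    simp only [List.map_cons, alternating, ih]
    push_cast
    ring

theorem evens_cons (c : ℤ) (l : List ℤ) : evens (c :: l) = c :: evens l.tail := by
  cases l <;> rfl

theorem alternating_eq (l : List ℤ) (z p q : ℂ) :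
    alternating l z p q =
      listVal (evens l) (z ^ 2) * p + z * listVal (evens l.tail) (z ^ 2) * q := by
  induction l generalizing p q with
  | nil => simp [alternating, evens, listVal]
  | cons c l ih =>
    rw [evens_cons, List.tail_cons, alternating, ih, listVal]
    ring

/-- Cauchy–Schwarz for the pairs (|E|, |O|) and (|p|, |q|), the even and odd parts being taken at
z². -/
theorem norm_alternating_le (l : List ℤ) {z p q : ℂ} {K S : ℝ} (hz : ‖z‖ = 1)
    (hK : ‖listVal (evens l) (z ^ 2)‖ ^ 2 + ‖listVal (evens l.tail) (z ^ 2)‖ ^ 2 ≤ K)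
    (hS : ‖p‖ ^ 2 + ‖q‖ ^ 2 = S) : ‖alternating l z p q‖ ≤ √(K * S) := by
  have hS' : 0 ≤ S := by rw [← hS]; positivity
  apply Real.le_sqrt_of_sq_le
  refine le_trans ?_ (mul_le_mul_of_nonneg_right hK hS')
  rw [alternating_eq, ← hS]
  have h := norm_add_le (listVal (evens l) (z ^ 2) * p) (z * listVal (evens l.tail) (z ^ 2) * q)
  rw [norm_mul, norm_mul, norm_mul, hz, one_mul] at h
  refine (pow_le_pow_left₀ (norm_nonneg _) h 2).trans ?_
  nlinarith [sq_nonneg (‖listVal (evens l) (z ^ 2)‖ * ‖q‖ -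
    ‖listVal (evens l.tail) (z ^ 2)‖ * ‖p‖)]

/-- The first `k` Rudin–Shapiro coefficients. -/
noncomputable def coeffs (k : ℕ) : List ℤ := (List.range k).map a

theorem partialSum_mul_two_pow (j k : ℕ) (z : ℂ) :
    partialSum (k * 2 ^ j) z =
      alternating (coeffs k) (z ^ 2 ^ j) (val (P j) z) (val (Q j) z) := by
  induction k with
  | zero => simp [partialSum, coeffs, alternating]
  | succ k ih =>
    rw [add_one_mul, partialSum_block_add j k le_rfl, ih]
    have e : coeffs (k + 1) = coeffs k ++ [a k] := by simp [coeffs, List.range_succ]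
    have hl : (coeffs k).length = k := by simp [coeffs]
    rw [e, alternating_append_singleton, hl]
    unfold block
    split_ifs
    · rw [(trunc_full j z).1]
    · rw [(trunc_full j z).2]

theorem norm_partialSum_mul_two_pow_le (j k : ℕ) {z : ℂ} (hz : ‖z‖ = 1) {K : ℤ}
    (hK : ∀ v : ℂ, ‖v‖ = 1 →
      ‖listVal (evens (coeffs k)) v‖ ^ 2 + ‖listVal (evens (coeffs k).tail) v‖ ^ 2 ≤ K) :
    ‖partialSum (k * 2 ^ j) z‖ ≤ √(K * (2 * 2 ^ j)) := by
  have hz' : ‖z ^ 2 ^ j‖ = 1 := by rw [norm_pow, hz, one_pow]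
  rw [partialSum_mul_two_pow]
  exact norm_alternating_le _ hz' (hK _ (by rw [norm_pow, hz', one_pow])) (norm_sq_val_PQ j hz)

/-! ### Computable coefficients and numerical certificates -/

/-- The Rudin–Shapiro coefficient of `n < 2 ^ f`: the parity of the number of occurrences of `11`
in the binary expansion of `n`. -/
def sign : ℕ → ℕ → ℤ
  | 0, _ => 1
  | f + 1, n => (if n % 4 = 3 then -1 else 1) * sign f (n / 2)

/-- Makes the coefficients available to kernel evaluation; `a` itself goes through noncomputable
polynomials. -/
theorem a_eq_sign {f n : ℕ} (h : n < 2 ^ f) : a n = sign f n := by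
  induction f generalizing n with
  | zero =>
    obtain rfl : n = 0 := by simpa using h
    rw [a_zero, sign]
  | succ f ih =>
    have hn : n / 2 < 2 ^ f := by rw [pow_succ] at h; omega
    have hr : n % 2 < 2 ^ 1 := by omega
    have e : n = n / 2 * 2 ^ 1 + n % 2 := by omega
    have hb := a_block 1 (k := n / 2) hr
    rw [← e, ih hn] at hb
    rw [hb, sign, mul_comm]
    congr 1
    unfold block
    rcases Nat.mod_two_eq_zero_or_one n with h0 | h1
    · have : ¬ n % 4 = 3 := by omega
      rw [h0, if_neg this]
      split_ifs <;> simp [P_succ, Q_succ, P_zero, Q_zero]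
    · rw [h1]
      have : Even (n / 2) ↔ ¬ n % 4 = 3 := by rw [Nat.even_iff]; omega
      simp only [this, ite_not]
      split_ifs <;> simp [P_succ, Q_succ, P_zero, Q_zero, coeff_one]

theorem abs_sign (f n : ℕ) : |sign f n| = 1 := by
  induction f generalizing n with
  | zero => rfl
  | succ f ih =>
    rw [sign, abs_mul, ih]
    split_ifs <;> rfl

theorem abs_a (n : ℕ) : |a n| = 1 := by
  rw [a_eq_sign (f := n) Nat.lt_two_pow_self, abs_sign]

/-- Twice the coefficients of `k` full blocks followed by half a block. -/
noncomputable def halfCoeffs (k : ℕ) : List ℤ := (coeffs k).map (2 * ·) ++ [a k]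

/-- The sum is split as the midpoint of the sums over k and k + 1 blocks, plus the deviation of a
truncated block from half of that block. The doubling in `halfCoeffs` keeps the midpoint integral,
so κ stands for √(K/2). -/
theorem norm_partialSum_block_add_le (j k : ℕ) {m : ℕ} (hm : m ≤ 2 ^ j) {z : ℂ} (hz : ‖z‖ = 1)
    {K : ℤ} {κ : ℝ} (hκ : 0 ≤ κ) (hKκ : (K : ℝ) ≤ 2 * κ ^ 2)
    (hK : ∀ v : ℂ, ‖v‖ = 1 →
      ‖listVal (evens (halfCoeffs k)) v‖ ^ 2 + ‖listVal (evens (halfCoeffs k).tail) v‖ ^ 2 ≤ K) :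
    ‖partialSum (k * 2 ^ j + m) z‖ ≤ (κ + (1 + √2 / 2)) * √(2 ^ j) - 1 := by
  have hz' : ‖z ^ 2 ^ j‖ = 1 := by rw [norm_pow, hz, one_pow]
  have h1 := norm_alternating_le (halfCoeffs k) hz' (hK _ (by rw [norm_pow, hz', one_pow]))
    (norm_sq_val_PQ j hz)
  have h2 := norm_trunc_block_sub_half_le j k hm hz
  have h3 : √(K * (2 * 2 ^ j)) ≤ 2 * (κ * √(2 ^ j)) := by
    apply Real.sqrt_le_iff.2
    refine ⟨by positivity, ?_⟩
    rw [mul_pow, mul_pow, Real.sq_sqrt (by positivity)]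
    nlinarith [pow_pos (zero_lt_two (α := ℝ)) j]
  have hl : (coeffs k).length = k := by simp [coeffs]
  have e : partialSum (k * 2 ^ j + m) z =
      alternating (halfCoeffs k) (z ^ 2 ^ j) (val (P j) z) (val (Q j) z) / 2 +
        a k * (z ^ 2 ^ j) ^ k * (trunc (block j k) m z - val (block j k) z / 2) := by
    have hb : val (block j k) z = if Even k then val (P j) z else val (Q j) z := by
      unfold block
      split_ifs <;> rfl
    rw [partialSum_block_add j k hm, partialSum_mul_two_pow, halfCoeffs,
      alternating_append_singleton, alternating_map_mul, List.length_map, hl, hb]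
    push_cast
    ring
  have ha' : ‖(a k : ℂ)‖ = 1 := by
    rw [Complex.norm_intCast]
    exact_mod_cast abs_a k
  rw [e]
  refine (norm_add_le _ _).trans ?_
  rw [norm_div, norm_mul, norm_mul, norm_pow, hz', ha', one_pow, one_mul, one_mul]
  norm_num
  linarith

theorem coeffs_eq {f k : ℕ} (h : k ≤ 2 ^ f) : coeffs k = (List.range k).map (sign f) :=
  List.map_congr_left fun _ hn => a_eq_sign ((List.mem_range.1 hn).trans_le h)

theorem coeffs_bound {k : ℕ} (g : List ℤ) (M K : ℤ) (hk : k ≤ 2 ^ 7) (hM : 0 < M)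
    (h : cosBound (listAdd ((listAdd (autocorr (evens ((List.range k).map (sign 7))))
      (autocorr (evens ((List.range k).map (sign 7)).tail))).map (M * M * ·)) (autocorr g)) ≤
      M * M * K) {v : ℂ} (hv : ‖v‖ = 1) :
    ‖listVal (evens (coeffs k)) v‖ ^ 2 + ‖listVal (evens (coeffs k).tail) v‖ ^ 2 ≤ K := by
  rw [coeffs_eq hk]
  exact norm_sq_evens_add_le hM h hv

theorem halfCoeffs_bound {k : ℕ} (g : List ℤ) (M K : ℤ) (hk : k < 2 ^ 7) (hM : 0 < M)
    (h : cosBound (listAdd ((listAdd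
      (autocorr (evens (((List.range k).map (sign 7)).map (2 * ·) ++ [sign 7 k])))
      (autocorr (evens (((List.range k).map (sign 7)).map (2 * ·) ++ [sign 7 k]).tail))).map
        (M * M * ·)) (autocorr g)) ≤ M * M * K) {v : ℂ} (hv : ‖v‖ = 1) :
    ‖listVal (evens (halfCoeffs k)) v‖ ^ 2 + ‖listVal (evens (halfCoeffs k).tail) v‖ ^ 2 ≤ K := by
  rw [halfCoeffs, coeffs_eq hk.le, a_eq_sign hk]
  exact norm_sq_evens_add_le hM h hv

/-- In this and the following certificates g/M acts as an approximate Fejér–Riesz factor of K - |E|²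
- |O|²; the constant term left over absorbs the rounding error in the other coefficients. -/
theorem halfCoeffs_seven {v : ℂ} (hv : ‖v‖ = 1) :
    ‖listVal (evens (halfCoeffs 7)) v‖ ^ 2 + ‖listVal (evens (halfCoeffs 7).tail) v‖ ^ 2 ≤
      (42 : ℤ) :=
  halfCoeffs_bound [19, 6, -5, 4] 6 42 (by norm_num) (by norm_num) (by decide +kernel) hv

theorem halfCoeffs_twelve {v : ℂ} (hv : ‖v‖ = 1) :
    ‖listVal (evens (halfCoeffs 12)) v‖ ^ 2 + ‖listVal (evens (halfCoeffs 12).tail) v‖ ^ 2 ≤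
      (88 : ℤ) :=
  halfCoeffs_bound [42, 3, 10, -2, -22, 3, 3] 8 88 (by norm_num) (by norm_num)
    (by decide +kernel) hv

theorem halfCoeffs_thirteen {v : ℂ} (hv : ‖v‖ = 1) :
    ‖listVal (evens (halfCoeffs 13)) v‖ ^ 2 + ‖listVal (evens (halfCoeffs 13).tail) v‖ ^ 2 ≤
      (98 : ℤ) :=
  halfCoeffs_bound [581, 29, 228, -30, -214, 29, 103] 100 98 (by norm_num) (by norm_num)
    (by decide +kernel) hv

theorem halfCoeffs_twenty_three {v : ℂ} (hv : ‖v‖ = 1) :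
    ‖listVal (evens (halfCoeffs 23)) v‖ ^ 2 + ‖listVal (evens (halfCoeffs 23).tail) v‖ ^ 2 ≤
      (197 : ℤ) :=
  halfCoeffs_bound [73, 5, -5, 3, -4, 0, -4, 4, -27, 2, -2, 2] 8 197 (by norm_num) (by norm_num)
    (by decide +kernel) hv

theorem halfCoeffs_forty_four {v : ℂ} (hv : ‖v‖ = 1) :
    ‖listVal (evens (halfCoeffs 44)) v‖ ^ 2 + ‖listVal (evens (halfCoeffs 44).tail) v‖ ^ 2 ≤
      (408 : ℤ) :=
  halfCoeffs_bound [1416, 19, 79, -11, -236, 15, 60, -13, -197, -14, 26, -9, -179, 14, 45, 17,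
    -372, 16, 22, -13, -100, 14, 14] 100 408 (by norm_num) (by norm_num) (by decide +kernel) hv

theorem halfCoeffs_eighty_seven {v : ℂ} (hv : ‖v‖ = 1) :
    ‖listVal (evens (halfCoeffs 87)) v‖ ^ 2 + ‖listVal (evens (halfCoeffs 87).tail) v‖ ^ 2 ≤
      (875 : ℤ) :=
  halfCoeffs_bound [1085, 17, -17, 12, -16, 2, -18, 17, -136, 15, -15, 9, -13, 0, -13, 13, -126,
    4, -4, -1, -11, 0, -11, 11, -106, 11, -11, 7, -1, 8, -1, 1, -226, 7, -7, 6, -6, -4, -6, 6, -69,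
    5, -5, 5] 50 875 (by norm_num) (by norm_num) (by decide +kernel) hv

theorem halfCoeffs_ninety {v : ℂ} (hv : ‖v‖ = 1) :
    ‖listVal (evens (halfCoeffs 90)) v‖ ^ 2 + ‖listVal (evens (halfCoeffs 90).tail) v‖ ^ 2 ≤
      (875 : ℤ) :=
  halfCoeffs_bound [1070, -17, 18, 19, 68, 18, -14, -15, -109, -3, 15, 15, 51, 13, -15, -11, -91,
    -3, -16, 4, 5, 4, -10, -10, -88, -2, 11, 12, 48, 12, 17, -2, -257, -6, 15, 7, 30, 6, -14, -6,
    -53, 4, 14, 5, 23, 5] 50 875 (by norm_num) (by norm_num) (by decide +kernel) hv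

theorem halfCoeffs_ninety_one {v : ℂ} (hv : ‖v‖ = 1) :
    ‖listVal (evens (halfCoeffs 91)) v‖ ^ 2 + ‖listVal (evens (halfCoeffs 91).tail) v‖ ^ 2 ≤
      (875 : ℤ) :=
  halfCoeffs_bound [2139, -38, 12, 41, 173, 37, -10, -33, -192, -9, 11, 32, 128, 27, -11, -24,
    -158, -8, -12, 8, 3, 11, -6, -23, -156, -7, 7, 26, 127, 25, 11, -6, -534, -14, 10, 15, 79, 12,
    -10, -13, -90, 7, 9, 10, 66, 9] 100 875 (by norm_num) (by norm_num) (by decide +kernel) hv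

theorem coeffs_three {v : ℂ} (hv : ‖v‖ = 1) :
    ‖listVal (evens (coeffs 3)) v‖ ^ 2 + ‖listVal (evens (coeffs 3).tail) v‖ ^ 2 ≤ (5 : ℤ) :=
  coeffs_bound [1, -1] 1 5 (by norm_num) (by norm_num) (by decide +kernel) hv

theorem coeffs_eleven {v : ℂ} (hv : ‖v‖ = 1) :
    ‖listVal (evens (coeffs 11)) v‖ ^ 2 + ‖listVal (evens (coeffs 11).tail) v‖ ^ 2 ≤ (26 : ℤ) :=
  coeffs_bound [28, -5, -4, -4, -7, -2] 8 26 (by norm_num) (by norm_num) (by decide +kernel) hv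

theorem coeffs_forty_five {v : ℂ} (hv : ‖v‖ = 1) :
    ‖listVal (evens (coeffs 45)) v‖ ^ 2 + ‖listVal (evens (coeffs 45).tail) v‖ ^ 2 ≤ (112 : ℤ) :=
  coeffs_bound [112, 3, 6, -2, -13, 2, 5, -2, -11, -2, 1, -1, -10, 2, 4, 2, -27, 2, 3, -2, -6, 2, 2]
    15 112 (by norm_num) (by norm_num) (by decide +kernel) hv

/-! ### Direct estimates away from the inductive range -/

/-- The bound on a dyadic interval `[k 2^j, (k + 1) 2^j]`. -/
theorem norm_partialSum_le_of_mem_dyadic {j k n : ℕ} (h1 : k * 2 ^ j ≤ n)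
    (h2 : n ≤ (k + 1) * 2 ^ j) {z : ℂ} (hz : ‖z‖ = 1) {K : ℤ} {κ : ℝ} (hκ : 0 ≤ κ)
    (hKκ : (K : ℝ) ≤ 2 * κ ^ 2)
    (hK : ∀ v : ℂ, ‖v‖ = 1 →
      ‖listVal (evens (halfCoeffs k)) v‖ ^ 2 + ‖listVal (evens (halfCoeffs k).tail) v‖ ^ 2 ≤ K) :
    ‖partialSum n z‖ ≤ (κ + 1.70711) * √(2 ^ j) - 1 := by
  obtain ⟨m, rfl⟩ := Nat.exists_eq_add_of_le h1
  have hm : m ≤ 2 ^ j := by rw [add_one_mul] at h2; omega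
  refine (norm_partialSum_block_add_le j k hm hz hκ hKκ hK).trans ?_
  have h3 : √(2 : ℝ) ≤ 1.41422 := Real.sqrt_le_iff.2 (by norm_num)
  gcongr
  norm_num at h3 ⊢
  linarith

theorem sqrt_two_pow_add (j s : ℕ) : √((2 : ℝ) ^ (j + s)) = √(2 ^ s) * √(2 ^ j) := by
  rw [pow_add, mul_comm, Real.sqrt_mul (by positivity)]

theorem one_le_sqrt_two_pow (j : ℕ) : 1 ≤ √((2 : ℝ) ^ j) :=
  Real.one_le_sqrt.2 (one_le_pow₀ (by norm_num))

/-- The 2 added to A² pays for the -2 under the root, since 2^j ≥ 1. -/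
theorem mul_sqrt_sub_le {A : ℝ} {j k n : ℕ} (h1 : k * 2 ^ j ≤ n)
    (hA : A ^ 2 + 2 ≤ 6 * k) : A * √(2 ^ j) - 1 ≤ √(6 * (n : ℝ) - 2) - 1 := by
  refine sub_le_sub_right (Real.le_sqrt_of_sq_le ?_) 1
  rw [mul_pow, Real.sq_sqrt (by positivity)]
  have h2 : (k : ℝ) * 2 ^ j ≤ n := by exact_mod_cast h1
  have h3 : (1 : ℝ) ≤ 2 ^ j := one_le_pow₀ (by norm_num)
  nlinarith

/-- The range [23/32, 1) of n/2^(t+1) is covered by [7/8, 1], [13/16, 14/16], [12/16, 13/16] and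
[23/32, 24/32]. -/
theorem norm_partialSum_le_of_upper {t n : ℕ} (h1 : 23 * 2 ^ (t + 1) ≤ 32 * n)
    (h2 : n < 2 ^ (t + 1)) (h3 : 2 * 2 ^ (t + 1) + 1 < 3 * n) {z : ℂ} (hz : ‖z‖ = 1) :
    ‖partialSum n z‖ ≤ √(6 * (n : ℝ) - 2) - 1 := by
  rcases lt_or_ge t 2 with ht | ht
  · interval_cases t <;> omega
  obtain ⟨j, rfl⟩ := Nat.exists_eq_add_of_le' ht
  have e : 2 ^ (j + 2 + 1) = 8 * 2 ^ j := by ring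
  rw [e] at h1 h2 h3
  rcases le_or_gt (7 * 2 ^ j) n with h7 | h7
  · refine (norm_partialSum_le_of_mem_dyadic h7 (by omega) hz (κ := 4.583) (by norm_num)
      (by norm_num) fun v => halfCoeffs_seven).trans (mul_sqrt_sub_le h7 (by norm_num))
  rcases j with _ | j
  -- Too short for eighths to be halved again; 6 = 3 · 2 is a sum of whole blocks.
  · obtain rfl : n = 6 := by omega
    have h := norm_partialSum_mul_two_pow_le 1 3 hz fun v => coeffs_three
    refine h.trans ?_
    rw [le_sub_iff_add_le]
    apply Real.le_sqrt_of_sq_le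
    have h4 : √(((5 : ℤ) : ℝ) * (2 * 2 ^ 1)) ≤ 4.5 := Real.sqrt_le_iff.2 (by norm_num)
    have h5 := Real.sqrt_nonneg (((5 : ℤ) : ℝ) * (2 * 2 ^ 1))
    refine (pow_le_pow_left₀ (by linarith) (add_le_add_left h4 1) 2).trans ?_
    norm_num
  rw [pow_succ] at h1 h2 h3 h7
  rcases le_or_gt (13 * 2 ^ j) n with h13 | h13
  · refine (norm_partialSum_le_of_mem_dyadic h13 (by omega) hz (κ := 7) (by norm_num)
      (by norm_num) fun v => halfCoeffs_thirteen).trans (mul_sqrt_sub_le h13 (by norm_num))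
  rcases le_or_gt (12 * 2 ^ j) n with h12 | h12
  · refine (norm_partialSum_le_of_mem_dyadic h12 (by omega) hz (κ := 6.634) (by norm_num)
      (by norm_num) fun v => halfCoeffs_twelve).trans (mul_sqrt_sub_le h12 (by norm_num))
  rcases j with _ | j
  · omega
  rw [pow_succ] at h1 h2 h3 h12
  have h23 : 23 * 2 ^ j ≤ n := by omega
  exact (norm_partialSum_le_of_mem_dyadic h23 (by omega) hz (κ := 9.925) (by norm_num)
      (by norm_num) fun v => halfCoeffs_twenty_three).trans (mul_sqrt_sub_le h23 (by norm_num))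

/-- In units of 2^t/128 the range [87, 92] is covered by [87, 88], [88, 90] (block 44 of double
length), [90, 91] and [91, 92]. -/
theorem norm_partialSum_le_of_middle {t n : ℕ} (h1 : 87 * 2 ^ t ≤ 128 * n)
    (h2 : 32 * n < 23 * 2 ^ t) (h3 : 2 * 2 ^ t + 1 < 3 * n) {z : ℂ} (hz : ‖z‖ = 1) :
    ‖partialSum n z‖ ≤ 2 * √(2 ^ t) - 1 := by
  have h128 : (22.6241 : ℝ) ≤ 2 * √(2 ^ 7) := by
    have : (22.6241 / 2 : ℝ) ≤ √(2 ^ 7) := Real.le_sqrt_of_sq_le (by norm_num)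
    linarith
  rcases lt_or_ge t 7 with ht | ht
  · have h11 : ∀ j, ‖partialSum (11 * 2 ^ j) z‖ ≤ 2 * √(2 ^ (j + 4)) - 1 ∨ j = 0 := by
      intro j
      rcases j with _ | j
      · exact Or.inr rfl
      refine Or.inl ((norm_partialSum_mul_two_pow_le (j + 1) 11 hz fun v => coeffs_eleven).trans ?_)
      have h5 : √((2 : ℝ) ^ 4) = 4 := by rw [Real.sqrt_eq_iff_mul_self_eq] <;> norm_num
      have h6 : (1.4 : ℝ) ≤ √(2 ^ (j + 1)) := by
        refine Real.le_sqrt_of_sq_le ?_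
        have : (1 : ℝ) ≤ 2 ^ j := one_le_pow₀ (by norm_num)
        rw [pow_succ (2 : ℝ) j]
        norm_num
        linarith
      have h7 : √(((26 : ℤ) : ℝ) * (2 * 2 ^ (j + 1))) ≤ 7.22 * √(2 ^ (j + 1)) := by
        rw [← mul_assoc, Real.sqrt_mul (by norm_num)]
        refine mul_le_mul_of_nonneg_right ?_ (Real.sqrt_nonneg _)
        exact Real.sqrt_le_iff.2 (by norm_num)
      rw [sqrt_two_pow_add, h5]
      refine h7.trans ?_
      norm_num at h6 ⊢
      linarith
    -- For t ≤ 4 no n is left: the only integer in range is 11 at t = 4, excluded by the strict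
    -- inequality `h3`.
    interval_cases t
    · omega
    · omega
    · omega
    · omega
    · omega
    · obtain rfl : n = 22 := by omega
      exact (h11 1).resolve_right one_ne_zero
    · have hn : n = 44 ∨ n = 45 := by omega
      rcases hn with rfl | rfl
      · exact (h11 2).resolve_right two_ne_zero
      · refine (norm_partialSum_mul_two_pow_le 0 45 hz fun v => coeffs_forty_five).trans ?_
        have h8 : √((2 : ℝ) ^ 6) = 8 := by rw [Real.sqrt_eq_iff_mul_self_eq] <;> norm_num
        rw [h8]
        exact Real.sqrt_le_iff.2 (by norm_num)
  obtain ⟨j, rfl⟩ := Nat.exists_eq_add_of_le' ht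
  have e : 2 ^ (j + 7) = 128 * 2 ^ j := by ring
  rw [e] at h1 h2 h3
  have key : ∀ {k : ℕ}, k * 2 ^ j ≤ n → n ≤ (k + 1) * 2 ^ j → (∀ v : ℂ, ‖v‖ = 1 →
      ‖listVal (evens (halfCoeffs k)) v‖ ^ 2 + ‖listVal (evens (halfCoeffs k).tail) v‖ ^ 2 ≤
        (875 : ℤ)) → ‖partialSum n z‖ ≤ 2 * √(2 ^ (j + 7)) - 1 := by
    intro k hk1 hk2 hK
    -- The margin is thin: 20.9169 + 1.70711 = 22.62401, against 2√128 ≥ 22.6241.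
    refine (norm_partialSum_le_of_mem_dyadic hk1 hk2 hz (κ := 20.9169) (by norm_num) (by norm_num)
      hK).trans ?_
    rw [sqrt_two_pow_add, ← mul_assoc]
    refine sub_le_sub_right (mul_le_mul_of_nonneg_right (le_trans ?_ h128) (Real.sqrt_nonneg _)) 1
    norm_num
  rcases le_or_gt (91 * 2 ^ j) n with h91 | h91
  · exact key h91 (by omega) fun v => halfCoeffs_ninety_one
  rcases le_or_gt (90 * 2 ^ j) n with h90 | h90
  · exact key h90 (by omega) fun v => halfCoeffs_ninety
  rcases le_or_gt n (88 * 2 ^ j) with h88 | h88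
  · exact key (k := 87) (by omega) (by omega) fun v => halfCoeffs_eighty_seven
  have e2 : 2 ^ (j + 1) = 2 * 2 ^ j := by ring
  refine (norm_partialSum_le_of_mem_dyadic (j := j + 1) (k := 44) (by omega) (by omega) hz
    (κ := 14.283) (by norm_num) (by norm_num) fun v => halfCoeffs_forty_four).trans ?_
  have h8 : √((2 : ℝ) ^ 6) = 8 := by rw [Real.sqrt_eq_iff_mul_self_eq] <;> norm_num
  rw [show j + 7 = j + 1 + 6 from rfl, sqrt_two_pow_add (j + 1) 6, h8, ← mul_assoc]
  refine sub_le_sub_right (mul_le_mul_of_nonneg_right ?_ (Real.sqrt_nonneg _)) 1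
  norm_num

/-! ### The induction -/

theorem norm_val_P_succ_le (t : ℕ) {z : ℂ} (hz : ‖z‖ = 1) :
    ‖val (P t) z‖ ≤ √(2 ^ (t + 1)) := by
  rw [pow_succ', Real.sqrt_mul (by norm_num)]
  exact (norm_val_PQ_le t hz).1

theorem norm_partialSum_two_pow_succ_add_le (t : ℕ) {m : ℕ} (hm : m ≤ 2 ^ t) {z : ℂ}
    (hz : ‖z‖ = 1) :
    ‖partialSum (2 ^ (t + 1) + m) z‖ ≤ √(2 ^ (t + 2)) + ‖partialSum m z‖ := by
  rw [partialSum_two_pow_succ_add t hm]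
  refine (norm_add_le _ _).trans ?_
  rw [norm_mul, norm_pow, hz, one_pow, one_mul]
  exact add_le_add_left (norm_val_P_succ_le (t + 1) hz) _

theorem norm_partialSum_two_pow_succ_le (t : ℕ) {z : ℂ} (hz : ‖z‖ = 1) :
    ‖partialSum (2 ^ (t + 1)) z‖ ≤ √(6 * 2 ^ (t + 1) - 2) - 1 := by
  rw [partialSum_two_pow]
  refine (norm_val_P_succ_le (t + 1) hz).trans ?_
  have h1 : (1 : ℝ) ≤ 2 ^ t := one_le_pow₀ (by norm_num)
  have h2 : (2 : ℝ) ≤ √(2 ^ (t + 1 + 1)) := by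
    refine Real.le_sqrt_of_sq_le ?_
    rw [pow_succ (2 : ℝ) (t + 1), pow_succ (2 : ℝ) t]
    linarith
  have h3 : √((2 : ℝ) ^ (t + 1 + 1)) ^ 2 = 2 ^ (t + 1 + 1) := Real.sq_sqrt (by positivity)
  rw [le_sub_iff_add_le]
  refine Real.le_sqrt_of_sq_le ?_
  have h4 : (2 : ℝ) ^ (t + 1 + 1) = 2 * 2 ^ (t + 1) := by ring
  nlinarith

/-- After squaring, the cross term 2√(2N)√(6m-2) is at most 4N. -/
theorem sqrt_add_sqrt_le {N m : ℝ} (hm : 2 ≤ 6 * m) (h : 6 * m - 2 ≤ 2 * N) :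
    √(2 * N) + (√(6 * m - 2) - 1) ≤ √(6 * (N + m) - 2) - 1 := by
  have h1 : √(6 * m - 2) ≤ √(2 * N) := Real.sqrt_le_sqrt h
  have h2 : √(2 * N) ^ 2 = 2 * N := Real.sq_sqrt (by linarith)
  have h3 : √(6 * m - 2) ^ 2 = 6 * m - 2 := Real.sq_sqrt (by linarith)
  have h4 : √(2 * N) + √(6 * m - 2) ≤ √(6 * (N + m) - 2) := by
    refine Real.le_sqrt_of_sq_le ?_
    nlinarith [Real.sqrt_nonneg (2 * N)]
  linarith

/-- The bound `√(6 n - 2) - 1`, proved together with an upper bound for all `n < (23 / 32) 2^t`. -/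
theorem norm_partialSum_le_and (n : ℕ) {z : ℂ} (hz : ‖z‖ = 1) :
    (1 ≤ n → ‖partialSum n z‖ ≤ √(6 * (n : ℝ) - 2) - 1) ∧
    ∀ t : ℕ, 32 * n < 23 * 2 ^ t → ‖partialSum n z‖ ≤ 2 * √(2 ^ t) - 1 := by
  induction n using Nat.strong_induction_on with
  | _ n ih =>
  have mid : ∀ t : ℕ, 32 * n < 23 * 2 ^ t → 2 * 2 ^ t + 1 < 3 * n →
      ‖partialSum n z‖ ≤ 2 * √(2 ^ t) - 1 := by
    intro t h1 h2
    rcases lt_or_ge t 2 with ht | ht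
    · interval_cases t <;> omega
    rcases le_or_gt (87 * 2 ^ t) (128 * n) with h3 | h3
    · exact norm_partialSum_le_of_middle h3 h1 h2 hz
    obtain ⟨s, rfl⟩ := Nat.exists_eq_add_of_le' ht
    have e : 2 ^ (s + 2) = 4 * 2 ^ s := by ring
    have e' : 2 ^ (s + 1) = 2 * 2 ^ s := by ring
    rw [e] at h1 h2 h3
    obtain ⟨m, rfl⟩ := Nat.exists_eq_add_of_le (show 2 ^ (s + 1) ≤ n by omega)
    have hpos : 0 < 2 ^ s := by positivity
    -- Here m < (87/32 - 2)2^s = (23/32)2^s, so the second bound reproduces itself: √(2^(s+2)) +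
    -- 2√(2^s) = 2√(2^(s+2)).
    have h4 := (ih m (by omega)).2 s (by omega)
    have h5 := norm_partialSum_two_pow_succ_add_le s (m := m) (by omega) hz
    have h6 : √((2 : ℝ) ^ 2) = 2 := Real.sqrt_sq (by norm_num)
    have h7 := sqrt_two_pow_add s 2
    rw [h6] at h7
    linarith
  have main : 1 ≤ n → ‖partialSum n z‖ ≤ √(6 * (n : ℝ) - 2) - 1 := by
    intro hn
    obtain ⟨t, ht1, ht2⟩ : ∃ t, 2 ^ t ≤ n ∧ n < 2 ^ (t + 1) :=
      ⟨Nat.log 2 n, Nat.pow_log_le_self 2 (by omega), Nat.lt_pow_succ_log_self (by norm_num) n⟩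
    rcases le_or_gt (3 * n) (2 * 2 ^ (t + 1) + 1) with h1 | h1
    · rcases t with _ | t
      · obtain rfl : n = 1 := by simp at ht1 ht2; omega
        have h4 : √((4 : ℝ)) = 2 := by rw [Real.sqrt_eq_iff_mul_self_eq] <;> norm_num
        have h5 : (6 : ℝ) * (1 : ℕ) - 2 = 4 := by norm_num
        rw [h5, h4]
        simp [partialSum, a_zero]
        norm_num
      obtain ⟨m, rfl⟩ := Nat.exists_eq_add_of_le ht1
      rw [pow_succ 2 (t + 1)] at h1
      have e : 2 ^ (t + 1) = 2 * 2 ^ t := by ring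
      have hpos : 0 < 2 ^ t := by positivity
      -- The first bound is not available for m = 0, so pure powers of 2 are treated apart.
      rcases Nat.eq_zero_or_pos m with rfl | hm
      · simpa using norm_partialSum_two_pow_succ_le t hz
      have h2 := (ih m (by omega)).1 hm
      have h3 := norm_partialSum_two_pow_succ_add_le t (m := m) (by omega) hz
      have hm' : (1 : ℝ) ≤ m := by exact_mod_cast hm
      have hmN : (6 : ℝ) * m - 2 ≤ 2 * 2 ^ (t + 1) := by
        have : 6 * m ≤ 2 * 2 ^ (t + 1) + 2 := by omega
        have : (6 : ℝ) * m ≤ 2 * 2 ^ (t + 1) + 2 := by exact_mod_cast this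
        linarith
      have h4 := sqrt_add_sqrt_le (by linarith) hmN
      rw [pow_succ' 2 (t + 1)] at h3
      push_cast
      linarith
    · rcases lt_or_ge (32 * n) (23 * 2 ^ (t + 1)) with h2 | h2
      · refine (mid (t + 1) h2 h1).trans (sub_le_sub_right (Real.le_sqrt_of_sq_le ?_) 1)
        rw [mul_pow, Real.sq_sqrt (by positivity)]
        have : 2 * 2 ^ (t + 1) + 2 ≤ 3 * n := h1
        have : (2 : ℝ) * 2 ^ (t + 1) + 2 ≤ 3 * n := by exact_mod_cast this
        linarith
      · exact norm_partialSum_le_of_upper h2 ht2 h1 hz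
  refine ⟨main, fun t ht => ?_⟩
  rcases lt_or_ge (2 * 2 ^ t + 1) (3 * n) with h | h
  · exact mid t ht h
  rcases Nat.eq_zero_or_pos n with rfl | hn
  · have := one_le_sqrt_two_pow t
    simp [partialSum]
    linarith
  refine (main hn).trans (sub_le_sub_right (Real.sqrt_le_iff.2 ⟨by positivity, ?_⟩) 1)
  rw [mul_pow, Real.sq_sqrt (by positivity)]
  have : (3 : ℝ) * n ≤ 2 * 2 ^ t + 1 := by exact_mod_cast h
  linarith

theorem norm_partialSum_le_sqrt_six (n : ℕ) {z : ℂ} (hz : ‖z‖ = 1) :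
    ‖partialSum n z‖ ≤ √6 * √(n : ℝ) := by
  rcases Nat.eq_zero_or_pos n with rfl | hn
  · simp [partialSum]
  refine ((norm_partialSum_le_and n hz).1 hn).trans ?_
  rw [← Real.sqrt_mul (by norm_num)]
  have : √(6 * (n : ℝ) - 2) ≤ √(6 * (n : ℝ)) := Real.sqrt_le_sqrt (by linarith)
  linarith

/-! ### Sharpness at z = 1 -/

theorem val_PQ_one (k : ℕ) : val (P (2 * k)) 1 = 2 ^ k ∧ val (Q (2 * k)) 1 = 2 ^ k := by
  induction k with
  | zero => simpa using val_zero 1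
  | succ k ih =>
    have e : 2 * (k + 1) = 2 * k + 1 + 1 := by ring
    rw [e, (val_PQ_succ (2 * k + 1) 1).1, (val_PQ_succ (2 * k + 1) 1).2, (val_PQ_succ (2 * k) 1).1,
      (val_PQ_succ (2 * k) 1).2, ih.1, ih.2]
    constructor <;> ring

/-- The lengths `(2 * 4 ^ k + 1) / 3` and the values of the corresponding partial sums at `1`. -/
theorem exists_partialSum_one (k : ℕ) :
    ∃ n : ℕ, 3 * n = 2 * 4 ^ k + 1 ∧ partialSum n 1 = 2 ^ (k + 1) - 1 := by
  induction k with
  | zero => exact ⟨1, by norm_num, by norm_num [partialSum, a_zero]⟩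
  | succ k ih =>
    obtain ⟨m, hm, h⟩ := ih
    have e : 2 ^ (2 * k) = 4 ^ k := by rw [pow_mul]; norm_num
    have hpos : 0 < 4 ^ k := by positivity
    -- With N = 2^(2k+1), 3m = 2·4^k + 1 says 6m - 2 = 2N, the equality case of `sqrt_add_sqrt_le`.
    refine ⟨2 ^ (2 * k + 1) + m, ?_, ?_⟩
    · rw [pow_succ, pow_succ, e]
      omega
    · rw [partialSum_two_pow_succ_add (2 * k) (by omega), h, (val_PQ_succ _ 1).1,
        (val_PQ_one k).1, (val_PQ_one k).2]
      ring

theorem sharp (k : ℕ) : ∃ n : ℕ, (n : ℝ) = (2 * 4 ^ k + 1) / 3 ∧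
    ‖partialSum n 1‖ = 2 ^ (k + 1) - 1 ∧ ‖partialSum n 1‖ = √(6 * (n : ℝ) - 2) - 1 := by
  obtain ⟨n, hn, h⟩ := exists_partialSum_one k
  have hn' : (3 : ℝ) * n = 2 * 4 ^ k + 1 := by exact_mod_cast hn
  have h1 : (1 : ℝ) ≤ 2 ^ (k + 1) := one_le_pow₀ (by norm_num)
  have h2 : ‖partialSum n 1‖ = 2 ^ (k + 1) - 1 := by
    have : (2 : ℂ) ^ (k + 1) - 1 = ((2 ^ (k + 1) - 1 : ℝ) : ℂ) := by push_cast; rfl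
    rw [h, this, Complex.norm_of_nonneg (by linarith)]
  have h3 : 6 * (n : ℝ) - 2 = (2 ^ (k + 1)) ^ 2 := by
    have : (4 : ℝ) ^ k = 2 ^ k * 2 ^ k := by rw [← mul_pow]; norm_num
    rw [pow_succ (2 : ℝ) k]
    linear_combination 2 * hn' + 4 * this
  refine ⟨n, by linarith, h2, ?_⟩
  rw [h2, h3, Real.sqrt_sq (by positivity)]

end RudinShapiro

theorem theorem1 :
    -- the bound
    (∀ (n : ℕ) (z : ℂ), 1 ≤ n → ‖z‖ = 1 →
      ‖RudinShapiro.partialSum n z‖ ≤ Real.sqrt (6 * (n : ℝ) - 2) - 1) ∧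
    -- the conjectured bound with constant `√6`
    (∀ (n : ℕ) (z : ℂ), ‖z‖ = 1 →
      ‖RudinShapiro.partialSum n z‖ ≤ Real.sqrt 6 * Real.sqrt (n : ℝ)) ∧
    -- sharpness at `z = 1` for `n = (2 * 4 ^ k + 1) / 3`
    (∀ k : ℕ, ∃ n : ℕ, (n : ℝ) = (2 * 4 ^ k + 1) / 3 ∧
      ‖RudinShapiro.partialSum n 1‖ = 2 ^ (k + 1) - 1 ∧
      ‖RudinShapiro.partialSum n 1‖ = Real.sqrt (6 * (n : ℝ) - 2) - 1) :=
  ⟨fun n _ hn hz => (RudinShapiro.norm_partialSum_le_and n hz).1 hn,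
    fun n _ hz => RudinShapiro.norm_partialSum_le_sqrt_six n hz, RudinShapiro.sharp⟩
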